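/- Fix a finite alphabet $A$. A class $\mathcal C$ of languages over $A$ is a \emph{quotienting lattice of regular languages} if all its members are regular, $\emptyset, A^*\in\mathcal C$, and $\mathcal C$ is closed under union, intersection, and the quotients $u^{-1}L=\{w : uw\in L\}$ and $Lu^{-1}=\{w : wu\in L\}$ by words $u\in A^*$. Let $\mathrm{Pol}(\mathcal C)$ be the smallest class of languages containing $\mathcal C$ and closed under union and under marked concatenation $(H,L)\mapsto HaL$, $a\in A$, and let $\text{co-Pol}(\mathcal C)=\{L : A^*\setminus L\in \mathrm{Pol}(\mathcal C)\}$. A language $K$ \emph{separates} $L_1$ from $L_2$ if $L_1\subseteq K$ and $L_2\cap K=\emptyset$. Let $\alpha:A^*\to M$ be a surjective morphism onto a finite monoid. A pair $(s,t)\in M^2$ is a \emph{$\mathcal C$-pair} (for $\alpha$) if no $K\in\mathcal C$ separates $\alpha^{-1}(s)$ from $\alpha^{-1}(t)$; it is a \emph{saturated $\mathcal C$-pair} (for $\alpha$) if no $K\in\mathcal C$ of the form $K=\alpha^{-1}(F)$ with $F\subseteq M$ separates $\alpha^{-1}(s)$ from $\alpha^{-1}(t)$. For a regular language $L$, let $\alpha_L:A^*\to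 M_L$ be its syntactic morphism, that is, the quotient map onto the finite monoid $M_L=A^*/{\equiv_L}$, where $u\equiv_L v$ iff $xuy\in L\Leftrightarrow xvy\in L$ for all $x,y\in A^*$. Let $\omega\ge 1$ be the least positive integer such that $s^\omega$ is idempotent for all $s\in M_L$. \textbf{Theorem.} Let $\mathcal C$ be a quotienting lattice of regular languages over $A$. For every regular language $L\subseteq A^*$, the following are equivalent: \begin{enumerate} \item $L\in \mathrm{Pol}(\mathcal C)\cap\text{co-Pol}(\mathcal C)$; \item $s^{\omega+1}=s^\omega t s^\omega$ for all $\mathcal C$-pairs $(s,t)\in M_L^2$ for $\alpha_L$; \item $s^{\omega+1}=s^\omega t s^\omega$ for all saturated $\mathcal C$-pairs $(s,t)\in M_L^2$ for $\alpha_L$. \end{enumerate} Moreover, for every surjective morphism $\alpha:A^*\to M$ onto a finite monoid, the saturated $\mathcal C$-pair relation for $\alpha$ is the transitive closure of the $\mathcal C$-pair relation for $\alpha$. -/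

import Mathlib

namespace PolClosure

universe u v

section Classes

variable {A : Type u}

/-- The right quotient `L u⁻¹ = {w | w u ∈ L}`.  (The left quotient `u⁻¹ L = {w | u w ∈ L}` is
Mathlib's `Language.leftQuotient`.) -/
def rightQuotient (L : Language A) (u : List A) : Language A := {w | w ++ u ∈ L}

/-- A quotienting lattice of regular languages over `A`: a set of regular languages that contains
the empty language and the language of all words, and that is closed under union, intersection and
left and right quotients by words. -/
structure IsQuotientingLattice (𝒞 : Set (Language A)) : Prop where
  regular : ∀ L ∈ 𝒞, L.IsRegular
  empty_mem : (⊥ : Language A) ∈ 𝒞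
  univ_mem : (⊤ : Language A) ∈ 𝒞
  union_mem : ∀ K ∈ 𝒞, ∀ L ∈ 𝒞, K ⊔ L ∈ 𝒞
  inter_mem : ∀ K ∈ 𝒞, ∀ L ∈ 𝒞, K ⊓ L ∈ 𝒞
  leftQuotient_mem : ∀ L ∈ 𝒞, ∀ u : List A, L.leftQuotient u ∈ 𝒞
  rightQuotient_mem : ∀ L ∈ 𝒞, ∀ u : List A, rightQuotient L u ∈ 𝒞

/-- Membership in the polynomial closure: the least class that contains `𝒞` and is closed under
union and under marked concatenation `H, L ↦ H a L` with a letter `a`. -/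
inductive InPol (𝒞 : Set (Language A)) : Language A → Prop
  | base (L : Language A) : L ∈ 𝒞 → InPol 𝒞 L
  | union (H L : Language A) : InPol 𝒞 H → InPol 𝒞 L → InPol 𝒞 (H ⊔ L)
  | marked (H L : Language A) (a : A) : InPol 𝒞 H → InPol 𝒞 L → InPol 𝒞 (H * {[a]} * L)

/-- The class `Pol(𝒞)`. -/
def Pol (𝒞 : Set (Language A)) : Set (Language A) := {L | InPol 𝒞 L}

/-- The class `co-Pol(𝒞)` of the complements of the languages in `Pol(𝒞)`. -/
def coPol (𝒞 : Set (Language A)) : Set (Language A) := {L | Lᶜ ∈ Pol 𝒞}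

/-- `K` separates `L₁` from `L₂`. -/
def Separates (K L₁ L₂ : Language A) : Prop := L₁ ≤ K ∧ L₂ ⊓ K = ⊥

/-- `L₁` is `𝒞`-separable from `L₂`. -/
def Separable (𝒞 : Set (Language A)) (L₁ L₂ : Language A) : Prop := ∃ K ∈ 𝒞, Separates K L₁ L₂

variable {M : Type v} [Monoid M]

/-- The inverse image `α⁻¹(F)`, as a language. -/
def preimage (α : FreeMonoid A →* M) (F : Set M) : Language A :=
  {w : List A | α (FreeMonoid.ofList w) ∈ F}

/-- `L` is recognized by the morphism `α`. -/
def Recognizes (α : FreeMonoid A →* M) (L : Language A) : Prop := ∃ F : Set M, L = preimage α F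

/-- `(s, t)` is a `𝒞`-pair for `α`. -/
def IsPair (𝒞 : Set (Language A)) (α : FreeMonoid A →* M) (s t : M) : Prop :=
  ¬ Separable 𝒞 (preimage α {s}) (preimage α {t})

/-- `(s, t)` is a saturated `𝒞`-pair for `α`. -/
def IsSaturatedPair (𝒞 : Set (Language A)) (α : FreeMonoid A →* M) (s t : M) : Prop :=
  ¬ ∃ K ∈ 𝒞, Recognizes α K ∧ Separates K (preimage α {s}) (preimage α {t})

end Classes

section Omega

variable (M : Type v) [Monoid M]

/-- The number `ω(M)`: the least positive `n` such that `s ^ n` is idempotent for all `s : M`. It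
exists when `M` is finite, see `omega_spec`. -/
noncomputable def omega : ℕ := sInf {n : ℕ | 0 < n ∧ ∀ s : M, IsIdempotentElem (s ^ n)}

theorem omega_spec [Finite M] : 0 < omega M ∧ ∀ s : M, IsIdempotentElem (s ^ omega M) := by
  have key : ∀ s : M, ∃ n : ℕ, 0 < n ∧ IsIdempotentElem (s ^ n) := by
    intro s
    obtain ⟨i, j, hne, hij⟩ := Finite.exists_ne_map_eq_of_infinite (fun n : ℕ => s ^ n)
    wlog hlt : i < j generalizing i j
    · exact this j i hne.symm hij.symm (by omega)
    obtain ⟨p, rfl⟩ : ∃ p, j = i + p := ⟨j - i, by omega⟩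
    have hp : 0 < p := by omega
    have hstep : ∀ m k : ℕ, i ≤ m → s ^ (m + k * p) = s ^ m := by
      intro m k hm
      induction k with
      | zero => simp
      | succ k ih =>
        obtain ⟨d, rfl⟩ : ∃ d, m = i + d := ⟨m - i, by omega⟩
        have h1 : i + d + (k + 1) * p = (i + p) + (d + k * p) := by ring
        have hij' : s ^ i = s ^ (i + p) := hij
        rw [h1, pow_add s (i + p), ← hij', ← pow_add, ← add_assoc]
        exact ih
    refine ⟨(i + 1) * p, by positivity, ?_⟩
    have := hstep ((i + 1) * p) (i + 1) (by nlinarith)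
    rw [IsIdempotentElem, ← pow_add]
    exact this
  choose f hf hidem using key
  have := Fintype.ofFinite M
  refine Nat.sInf_mem (s := {n : ℕ | 0 < n ∧ ∀ s : M, IsIdempotentElem (s ^ n)}) ?_
  refine ⟨∏ s : M, f s, Finset.prod_pos fun s _ => hf s, fun s => ?_⟩
  obtain ⟨k, hk⟩ := Finset.dvd_prod_of_mem f (Finset.mem_univ s)
  rw [hk, pow_mul]
  exact (hidem s).pow k

end Omega

section Canonical

variable {A : Type u}

/-- The syntactic congruence of `L`: two words `u`, `v` are equivalent when
`x u y ∈ L ↔ x v y ∈ L` for all words `x`, `y`. -/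
def syntCon (L : Language A) : Con (FreeMonoid A) where
  r u v := ∀ x y : List A, x ++ u.toList ++ y ∈ L ↔ x ++ v.toList ++ y ∈ L
  iseqv :=
    ⟨fun _ _ _ => Iff.rfl, fun h x y => (h x y).symm, fun h h' x y => (h x y).trans (h' x y)⟩
  mul' := by
    intro u u' v v' hu hv x y
    have h1 := hu x (v.toList ++ y)
    have h2 := hv (x ++ u'.toList) y
    simp only [FreeMonoid.toList_mul, List.append_assoc] at h1 h2 ⊢
    exact h1.trans h2

/-- The syntactic monoid of `L`. -/
abbrev SyntMonoid (L : Language A) : Type u := (syntCon L).Quotient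

/-- The syntactic morphism of `L`, which maps a word to its class. -/
def syntHom (L : Language A) : FreeMonoid A →* SyntMonoid L := (syntCon L).mk'

/-- The syntactic monoid of a regular language is finite, so `omega_spec` applies to it. -/
theorem finite_syntMonoid {L : Language A} (hL : L.IsRegular) : Finite (SyntMonoid L) := by
  obtain ⟨σ, _, D, rfl⟩ := hL
  let f : FreeMonoid A → (σ → σ) := fun w q => D.evalFrom q w.toList
  have hf : ∀ u v : FreeMonoid A, f u = f v → syntCon D.accepts u v := by
    intro u v h x y
    have h' := congrFun h (D.eval x)
    simp only [f, DFA.eval] at h'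
    simp only [DFA.mem_accepts, DFA.eval, DFA.evalFrom_of_append, h']
  refine Finite.of_injective
    (fun s : SyntMonoid D.accepts => f (Function.surjInv Con.mk'_surjective s)) ?_
  intro s t hst
  have h := hf _ _ hst
  rw [← Function.surjInv_eq (Con.mk'_surjective (c := syntCon D.accepts)) s,
    ← Function.surjInv_eq (Con.mk'_surjective (c := syntCon D.accepts)) t]
  exact (Con.eq _).2 h

end Canonical

end PolClosure

/-!
A finite family of languages of `𝒞` only sees a preorder on words, so `(s, t)` is a `𝒞`-pair
exactly when, for each finite family, some word of `α⁻¹(s)` lies below some word of `α⁻¹(t)`.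
Moreover some language of `𝒞` contains `α⁻¹(s)` and only words whose image `t` forms a pair
`(s, t)`; the union of these languages over all elements reachable from `s` by pairs is the least
language of `𝒞` that is recognized by `α` and contains `α⁻¹(s)`, whence the transitive closure.

Modulo multiplication by powers of `s`, the identity `s ^ (ω + 1) = s ^ ω t s ^ ω` says that
`e t e = e` for all pairs `(e, t)` with `e` idempotent. If it holds, then `p t q = p s q` for every
pair `(s, t)` such that `p` and `q` are `𝒥`-equivalent to `p s q`. Now mark in a word of `α⁻¹(m)`
the last letter of its shortest prefix, and the first letter of its shortest suffix, whose image
is `𝒥`-below `m`. What precedes the first mark and what follows the second is strictly `𝒥`-above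
`m`, so by induction it is described by a language of `Pol(𝒞)`. The factor between the marks, of
image `s` say, may be replaced by any word of a language of `𝒞` that contains `α⁻¹(s)` and only
words whose image forms a pair with `s`. If the marks cross or coincide, the first one alone
suffices.

Conversely, a language `L ∈ Pol(𝒞)` is built from finitely many languages of `𝒞`. A marked
concatenation cuts a word at one letter only, so among many consecutive factors of a word of `L`
one stays uncut and may be replaced by any word above it for the quotients of these languages.
Applied to `u ^ n` with `u ∈ α⁻¹(e)`, this gives `x e y ∈ F → x (e t e) y ∈ F` for `L = α⁻¹(F)`,
and the same for the complement gives equality.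
-/

namespace PolClosure

section Separation

variable {A M : Type*} {𝒞 : Set (Language A)}

theorem mem_of_finite_cover {𝒟 𝒮 : Set (Language A)} (hsup : SupClosed 𝒟) (hbot : ⊥ ∈ 𝒟)
    (h𝒮 : 𝒮.Finite) {L : Language A} (hcover : ∀ w ∈ L, ∃ K ∈ 𝒮, K ∈ 𝒟 ∧ w ∈ K ∧ K ≤ L) :
    L ∈ 𝒟 := by
  have hL : sSup {K | K ∈ 𝒮 ∧ K ∈ 𝒟 ∧ K ≤ L} = L := by
    refine le_antisymm (sSup_le fun K hK => hK.2.2) fun w hw => ?_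
    obtain ⟨K, hK𝒮, hK𝒟, hwK, hKL⟩ := hcover w hw
    have hle : K ≤ sSup {K | K ∈ 𝒮 ∧ K ∈ 𝒟 ∧ K ≤ L} := le_sSup ⟨hK𝒮, hK𝒟, hKL⟩
    exact hle hwK
  rw [← hL]
  exact hsup.sSup_mem (h𝒮.subset fun K hK => hK.1) hbot fun K hK => hK.2.1

/-- The preorder on words induced by a class `𝒟` of languages: every language of `𝒟` that contains
`u` also contains `v`. -/
def CanonicalLE (𝒟 : Set (Language A)) (u v : FreeMonoid A) : Prop :=
  ∀ K ∈ 𝒟, u.toList ∈ K → v.toList ∈ K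

theorem CanonicalLE.mono {𝒟 ℰ : Set (Language A)} (hle : 𝒟 ⊆ ℰ) {u v : FreeMonoid A}
    (h : CanonicalLE ℰ u v) : CanonicalLE 𝒟 u v :=
  fun K hK => h K (hle hK)

theorem mem_of_canonicalLE_closed (hsup : SupClosed 𝒞) (hinf : InfClosed 𝒞) (hbot : ⊥ ∈ 𝒞)
    (htop : ⊤ ∈ 𝒞) {𝒟 : Set (Language A)} (hfin : 𝒟.Finite) (hsub : 𝒟 ⊆ 𝒞) {L : Language A}
    (hL : ∀ u v : FreeMonoid A, CanonicalLE 𝒟 u v → u.toList ∈ L → v.toList ∈ L) : L ∈ 𝒞 := by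
  refine mem_of_finite_cover hsup hbot (hfin.finite_subsets.image sInf) fun w hw => ?_
  have hℰ : {K ∈ 𝒟 | w ∈ K} ⊆ 𝒟 := Set.sep_subset _ _
  refine ⟨_, Set.mem_image_of_mem sInf hℰ, hinf.sInf_mem (hfin.subset hℰ) htop (hℰ.trans hsub),
    fun K hK => hK.2, fun v hv => ?_⟩
  exact hL (.ofList w) (.ofList v) (fun K hK hwK => hv K ⟨hK, hwK⟩) hw

variable [Monoid M] {α : FreeMonoid A →* M}

theorem mem_preimage {F : Set M} {w : List A} :
    w ∈ preimage α F ↔ α (FreeMonoid.ofList w) ∈ F := Iff.rfl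

theorem preimage_mono {E F : Set M} (h : E ⊆ F) : preimage α E ≤ preimage α F := fun _ hw => h hw

theorem isPair_iff {s t : M} : IsPair 𝒞 α s t ↔
    ∀ K ∈ 𝒞, preimage α {s} ≤ K → ∃ w : FreeMonoid A, α w = t ∧ w.toList ∈ K := by
  have hmeet (K : Language A) : preimage α {t} ⊓ K ≠ ⊥ ↔
      ∃ w : FreeMonoid A, α w = t ∧ w.toList ∈ K := Set.nonempty_iff_ne_empty.symm
  simp only [IsPair, Separable, Separates, not_exists, not_and, ← hmeet, ne_eq]

theorem isSaturatedPair_iff_isPair {s t : M} :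
    IsSaturatedPair 𝒞 α s t ↔ IsPair {K ∈ 𝒞 | Recognizes α K} α s t := by
  simp only [IsSaturatedPair, IsPair, Separable, Set.mem_sep_iff, and_assoc]

theorem isSaturatedPair_iff {s t : M} : IsSaturatedPair 𝒞 α s t ↔
    ∀ F : Set M, preimage α F ∈ 𝒞 → preimage α {s} ≤ preimage α F → t ∈ Set.range α ∩ F := by
  rw [isSaturatedPair_iff_isPair, isPair_iff]
  constructor
  · intro h F hF hs
    obtain ⟨w, rfl, hw⟩ := h _ ⟨hF, F, rfl⟩ hs
    exact ⟨⟨w, rfl⟩, hw⟩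
  · rintro h _ ⟨hF, F, rfl⟩ hs
    obtain ⟨⟨w, rfl⟩, hw⟩ := h F hF hs
    exact ⟨w, rfl, hw⟩

theorem IsPair.isSaturatedPair {s t : M} (h : IsPair 𝒞 α s t) : IsSaturatedPair 𝒞 α s t :=
  fun ⟨K, hK, _, hsep⟩ => h ⟨K, hK, hsep⟩

theorem IsSaturatedPair.trans {s r t : M} (hsr : IsSaturatedPair 𝒞 α s r)
    (hrt : IsSaturatedPair 𝒞 α r t) : IsSaturatedPair 𝒞 α s t := by
  rw [isSaturatedPair_iff] at *
  intro F hF hs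
  exact hrt F hF (preimage_mono (Set.singleton_subset_iff.2 (hsr F hF hs).2))

theorem IsPair.refl_of_mem_range {s : M} (hs : s ∈ Set.range α) : IsPair 𝒞 α s s := by
  obtain ⟨w, rfl⟩ := hs
  exact isPair_iff.2 fun K _ hK => ⟨w, rfl, hK (Set.mem_singleton (α w))⟩

theorem IsSaturatedPair.left_mem_range (hbot : ⊥ ∈ 𝒞) {s t : M} (h : IsSaturatedPair 𝒞 α s t) :
    s ∈ Set.range α := by
  by_contra hs
  have hempty : preimage α {s} ≤ preimage α ∅ := fun w hw => hs ⟨.ofList w, hw⟩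
  exact (isSaturatedPair_iff.1 h ∅ hbot hempty).2

theorem exists_mem_le_preimage_setOf_isPair [Finite M] (hinf : InfClosed 𝒞) (htop : ⊤ ∈ 𝒞)
    (s : M) : ∃ K ∈ 𝒞, preimage α {s} ≤ K ∧ K ≤ preimage α {t | IsPair 𝒞 α s t} := by
  have hsep : ∀ t, ∃ K ∈ 𝒞, preimage α {s} ≤ K ∧
      (¬ IsPair 𝒞 α s t → preimage α {t} ⊓ K = ⊥) := by
    intro t
    by_cases ht : IsPair 𝒞 α s t
    · exact ⟨⊤, htop, le_top, fun h => absurd ht h⟩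
    · obtain ⟨K, hK, hsK, htK⟩ := not_not.1 ht
      exact ⟨K, hK, hsK, fun _ => htK⟩
  choose K hK hsK htK using hsep
  refine ⟨⨅ t, K t, hinf.iInf_mem htop hK, le_iInf hsK, fun w hw => ?_⟩
  by_contra hpair
  have hwK : w ∈ K (α (.ofList w)) := iInf_le K _ hw
  have hw_bot : w ∈ (⊥ : Language A) := htK _ hpair ▸ ⟨Set.mem_singleton _, hwK⟩
  exact hw_bot

theorem isSaturatedPair_iff_transGen [Finite M] (hsup : SupClosed 𝒞) (hinf : InfClosed 𝒞)
    (hbot : ⊥ ∈ 𝒞) (htop : ⊤ ∈ 𝒞) {s t : M} :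
    IsSaturatedPair 𝒞 α s t ↔ Relation.TransGen (IsPair 𝒞 α) s t := by
  constructor
  · intro h
    choose K hK hsK hKpair using
      exists_mem_le_preimage_setOf_isPair (𝒞 := 𝒞) (α := α) hinf htop
    have hreach : preimage α {r | Relation.TransGen (IsPair 𝒞 α) s r} ∈ 𝒞 :=
      mem_of_finite_cover hsup hbot (Set.finite_range K) fun w hw =>
        ⟨_, ⟨α (.ofList w), rfl⟩, hK _, hsK _ (Set.mem_singleton _),
          fun v hv => Relation.TransGen.tail hw (hKpair _ hv)⟩
    have hself : IsPair 𝒞 α s s := .refl_of_mem_range (h.left_mem_range hbot)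
    exact (isSaturatedPair_iff.1 h _ hreach
      (preimage_mono (Set.singleton_subset_iff.2 (.single hself)))).2
  · intro h
    induction h with
    | single h => exact h.isSaturatedPair
    | tail _ h ih => exact ih.trans h.isSaturatedPair

theorem exists_canonicalLE_of_isPair (hsup : SupClosed 𝒞) (hinf : InfClosed 𝒞) (hbot : ⊥ ∈ 𝒞)
    (htop : ⊤ ∈ 𝒞) {𝒟 : Set (Language A)} (hfin : 𝒟.Finite) (hsub : 𝒟 ⊆ 𝒞) {s t : M}
    (h : IsPair 𝒞 α s t) : ∃ u v : FreeMonoid A, α u = s ∧ α v = t ∧ CanonicalLE 𝒟 u v := by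
  let up : Language A := {w | ∃ u, α u = s ∧ CanonicalLE 𝒟 u (.ofList w)}
  have hup : up ∈ 𝒞 := mem_of_canonicalLE_closed hsup hinf hbot htop hfin hsub <| by
    rintro v w hvw ⟨u, hu, huv⟩
    exact ⟨u, hu, fun K hK huK => hvw K hK (huv K hK huK)⟩
  obtain ⟨v, hv, u, hu, huv⟩ :=
    isPair_iff.1 h up hup fun w hw => ⟨.ofList w, hw, fun _ _ => id⟩
  exact ⟨u, v, hu, hv, huv⟩

theorem covariant_mul_isPair (hquot : ∀ K ∈ 𝒞, ∀ u : List A, K.leftQuotient u ∈ 𝒞)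
    (hα : Function.Surjective α) : Covariant M M (· * ·) (IsPair 𝒞 α) := by
  intro x s t h
  rw [isPair_iff] at h ⊢
  intro K hK hs
  obtain ⟨z, rfl⟩ := hα x
  obtain ⟨w, rfl, hw⟩ := h _ (hquot K hK z.toList) fun w hw =>
    hs <| mem_preimage.2 <| by
      rw [FreeMonoid.ofList_append, map_mul, Set.mem_singleton_iff.1 (mem_preimage.1 hw)]
      rfl
  exact ⟨z * w, map_mul α z w, hw⟩

theorem covariant_swap_mul_isPair (hquot : ∀ K ∈ 𝒞, ∀ u : List A, rightQuotient K u ∈ 𝒞)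
    (hα : Function.Surjective α) : Covariant M M (Function.swap (· * ·)) (IsPair 𝒞 α) := by
  intro x s t h
  rw [isPair_iff] at h ⊢
  intro K hK hs
  obtain ⟨z, rfl⟩ := hα x
  obtain ⟨w, rfl, hw⟩ := h _ (hquot K hK z.toList) fun w hw =>
    hs <| mem_preimage.2 <| by
      rw [FreeMonoid.ofList_append, map_mul, Set.mem_singleton_iff.1 (mem_preimage.1 hw)]
      rfl
  exact ⟨w * z, map_mul α w z, hw⟩

end Separation

section IdempotentEquation

variable {M : Type*} {r : M → M → Prop}

theorem covariant_transGen {N : Type*} {μ : N → M → M} (hr : Covariant N M μ r) :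
    Covariant N M μ (Relation.TransGen r) :=
  fun n _ _ h => Relation.TransGen.lift (μ n) (fun _ _ => hr n) _ _ h

variable [Monoid M]

/-- The identity `e t e = e` for all `r`-related `e`, `t` with `e` idempotent: an `ω`-free form of
the identity `s ^ (ω + 1) = s ^ ω t s ^ ω` for `r`-related `s`, `t`. -/
def IdempotentEquation (r : M → M → Prop) : Prop :=
  ∀ e t : M, IsIdempotentElem e → r e t → e * t * e = e

theorem idempotentEquation_iff_omega [Finite M] (hr : Covariant M M (Function.swap (· * ·)) r) :
    IdempotentEquation r ↔
      ∀ s t : M, r s t → s ^ (omega M + 1) = s ^ omega M * t * s ^ omega M := by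
  obtain ⟨hpos, hidem⟩ := omega_spec M
  constructor
  · intro h s t hst
    have hpair : r (s * s ^ (omega M - 1)) (t * s ^ (omega M - 1)) := hr _ hst
    rw [mul_pow_sub_one hpos.ne'] at hpair
    calc s ^ (omega M + 1)
        = s ^ omega M * (t * s ^ (omega M - 1)) * s ^ omega M * s := by
          rw [pow_succ, h _ _ (hidem s) hpair]
      _ = s ^ omega M * t * (s ^ (omega M - 1) * s) * s ^ omega M := by
          rw [mul_assoc _ _ s, pow_mul_comm' s (omega M)]
          simp only [mul_assoc]
      _ = s ^ omega M * t * s ^ omega M := by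
          rw [pow_sub_one_mul hpos.ne', mul_assoc, (hidem s).eq]
  · intro h e t he het
    have heq := h e t het
    rwa [he.pow_eq hpos.ne', he.pow_eq (Nat.succ_ne_zero _), eq_comm] at heq

theorem IdempotentEquation.transGen (hleft : Covariant M M (· * ·) r)
    (hright : Covariant M M (Function.swap (· * ·)) r) (h : IdempotentEquation r) :
    IdempotentEquation (Relation.TransGen r) := by
  intro e t he het
  induction het with
  | single het => exact h e _ he het
  | @tail t t' _ htt' ih =>
    have hpair : r e (e * t' * e) := by
      have := hright e (hleft e htt')
      dsimp only [Function.swap] at this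
      rwa [ih] at this
    calc e * t' * e = e * (e * t' * e) * e := by
          simp only [← mul_assoc, he.eq]; simp only [mul_assoc, he.eq]
      _ = e := h e _ he hpair

end IdempotentEquation

section Green

variable {M : Type*} [Monoid M]

/-- Green's `𝒥`-preorder: `m` lies in the two-sided ideal generated by `n`. -/
def JLe (m n : M) : Prop := ∃ x y, m = x * n * y

theorem JLe.trans {l m n : M} (hlm : JLe l m) (hmn : JLe m n) : JLe l n := by
  obtain ⟨x, y, rfl⟩ := hlm
  obtain ⟨x', y', rfl⟩ := hmn
  exact ⟨x * x', y' * y, by simp only [mul_assoc]⟩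

theorem mul_jLe_left (m n : M) : JLe (m * n) m := ⟨1, n, by rw [one_mul]⟩

theorem mul_jLe_right (m n : M) : JLe (m * n) n := ⟨m, 1, by rw [mul_one]⟩

theorem wellFounded_strict_jLe [Finite M] : WellFounded fun n m : M => JLe m n ∧ ¬ JLe n m := by
  have : IsTrans M fun n m : M => JLe m n ∧ ¬ JLe n m :=
    ⟨fun _ _ _ h h' => ⟨h'.1.trans h.1, fun hc => h.2 (hc.trans h'.1)⟩⟩
  have : Std.Irrefl fun n m : M => JLe m n ∧ ¬ JLe n m := ⟨fun _ h => h.2 h.1⟩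
  exact Finite.wellFounded_of_trans_of_irrefl _

theorem eq_pow_mul_mul_pow {p x y : M} (h : p = x * p * y) (n : ℕ) : p = x ^ n * p * y ^ n := by
  induction n with
  | zero => simp only [pow_zero, one_mul, mul_one]
  | succ n ih =>
    calc p = x ^ n * (x * p * y) * y ^ n := by rw [← h, ← ih]
      _ = x ^ (n + 1) * p * y ^ (n + 1) := by rw [pow_succ x, pow_succ' y]; simp only [mul_assoc]

variable [Finite M]

theorem JLe.exists_eq_mul_right {p m : M} (h : JLe p (p * m)) : ∃ z, p = p * m * z := by
  obtain ⟨x, y, hxy⟩ := h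
  obtain ⟨hpos, hidem⟩ := omega_spec M
  have hp := eq_pow_mul_mul_pow (x := x) (y := m * y) (by simpa only [mul_assoc] using hxy)
    (omega M)
  refine ⟨y * (m * y) ^ (omega M - 1), ?_⟩
  calc p = x ^ omega M * p * ((m * y) ^ omega M * (m * y) ^ omega M) := by
        rw [(hidem _).eq]; exact hp
    _ = p * (m * y) ^ omega M := by rw [← mul_assoc, ← hp]
    _ = p * m * (y * (m * y) ^ (omega M - 1)) := by
        rw [← mul_pow_sub_one hpos.ne']; simp only [mul_assoc]

theorem JLe.exists_eq_mul_left {q m : M} (h : JLe q (m * q)) : ∃ z, q = z * (m * q) := by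
  obtain ⟨x, y, hxy⟩ := h
  obtain ⟨hpos, hidem⟩ := omega_spec M
  have hq := eq_pow_mul_mul_pow (x := x * m) (y := y) (by simpa only [mul_assoc] using hxy)
    (omega M)
  refine ⟨(x * m) ^ (omega M - 1) * x, ?_⟩
  calc q = (x * m) ^ omega M * (x * m) ^ omega M * q * y ^ omega M := by
        rw [(hidem _).eq]; exact hq
    _ = (x * m) ^ omega M * ((x * m) ^ omega M * q * y ^ omega M) := by simp only [mul_assoc]
    _ = (x * m) ^ (omega M - 1) * x * (m * q) := by
        rw [← hq, ← pow_sub_one_mul hpos.ne']; simp only [mul_assoc]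

theorem IdempotentEquation.mul_mul_eq {r : M → M → Prop}
    (hright : Covariant M M (Function.swap (· * ·)) r) (h : IdempotentEquation r) {p q s t : M}
    (hp : JLe p (p * s * q)) (hq : JLe q (p * s * q)) (hst : r s t) :
    p * t * q = p * s * q := by
  rw [mul_assoc] at hp
  obtain ⟨z, hz⟩ := hp.exists_eq_mul_right
  obtain ⟨c, hc⟩ := hq.exists_eq_mul_left
  have hpe : p * (s * (c * p)) = p :=
    calc p * (s * (c * p)) = p * (s * (c * (p * (s * q) * z))) := by rw [← hz]
      _ = p * (s * (c * (p * s * q))) * z := by simp only [mul_assoc]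
      _ = p := by rw [← hc, ← hz]
  have he : IsIdempotentElem (s * (c * p)) := by
    rw [IsIdempotentElem, mul_assoc, mul_assoc, hpe]
  calc p * t * q = p * (s * (c * p)) * t * (c * (p * (s * (c * p)) * s * q)) := by rw [hpe, ← hc]
    _ = p * (s * (c * p) * (t * (c * p)) * (s * (c * p))) * (s * q) := by simp only [mul_assoc]
    _ = p * s * q := by rw [h _ _ he (hright (c * p) hst), hpe, mul_assoc]

end Green

section Factorization

variable {A : Type*}

theorem mem_marked_iff {H L : Language A} {a : A} {w : List A} :
    w ∈ H * {[a]} * L ↔ ∃ x ∈ H, ∃ y ∈ L, w = x ++ [a] ++ y := by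
  simp only [Language.mem_mul]
  constructor
  · rintro ⟨_, ⟨x, hx, _, rfl, rfl⟩, y, hy, rfl⟩
    exact ⟨x, hx, y, hy, rfl⟩
  · rintro ⟨x, hx, y, hy, rfl⟩
    exact ⟨x ++ [a], ⟨x, hx, [a], rfl, rfl⟩, y, hy, rfl⟩

theorem exists_first_prefix {P : List A → Prop} (hnil : ¬ P []) {w : List A} (hw : P w) :
    ∃ x a z, w = x ++ [a] ++ z ∧ ¬ P x ∧ P (x ++ [a]) := by
  induction w using List.reverseRecOn with
  | nil => exact absurd hw hnil
  | append_singleton w a ih =>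
    by_cases hPw : P w
    · obtain ⟨x, b, z, rfl, hx, hxb⟩ := ih hPw
      exact ⟨x, b, z ++ [a], List.append_assoc _ _ _, hx, hxb⟩
    · exact ⟨w, a, [], (List.append_nil _).symm, hPw, hw⟩

theorem exists_last_suffix {P : List A → Prop} (hnil : ¬ P []) {w : List A} (hw : P w) :
    ∃ x a z, w = x ++ [a] ++ z ∧ P ([a] ++ z) ∧ ¬ P z := by
  induction w with
  | nil => exact absurd hw hnil
  | cons a w ih =>
    by_cases hPw : P w
    · obtain ⟨x, b, z, rfl, hbz, hz⟩ := ih hPw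
      exact ⟨a :: x, b, z, rfl, hbz, hz⟩
    · exact ⟨[], a, w, rfl, hw, hPw⟩

theorem exists_marked_factorization {P : List A → Prop} (hnil : ¬ P []) {w : List A} (hw : P w) :
    (∃ x a z, w = x ++ [a] ++ z ∧ ¬ P x ∧ ¬ P z) ∨
      ∃ x a v b y, w = x ++ [a] ++ (v ++ [b] ++ y) ∧
        ¬ P x ∧ P (x ++ [a]) ∧ P ([b] ++ y) ∧ ¬ P y := by
  obtain ⟨x, a, z, rfl, hx, hxa⟩ := exists_first_prefix hnil hw
  by_cases hz : P z
  · obtain ⟨v, b, y, rfl, hby, hy⟩ := exists_last_suffix hnil hz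
    exact .inr ⟨x, a, v, b, y, rfl, hx, hxa, hby, hy⟩
  · exact .inl ⟨x, a, z, rfl, hx, hz⟩

end Factorization

section PolOfEquation

variable {A M : Type*} [Monoid M] {𝒞 : Set (Language A)} {α : FreeMonoid A →* M}

theorem supClosed_pol : SupClosed (Pol 𝒞) := fun _ hH _ hL => .union _ _ hH hL

theorem mem_coPol {L : Language A} : L ∈ coPol 𝒞 ↔ Lᶜ ∈ Pol 𝒞 := Iff.rfl

theorem preimage_marked_le {p q m : M} {a : A} (hm : p * α (.of a) * q = m) :
    preimage α {p} * {[a]} * preimage α {q} ≤ preimage α {m} := by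
  intro w hw
  obtain ⟨x, rfl, y, rfl, rfl⟩ := mem_marked_iff.1 hw
  refine mem_preimage.2 ?_
  simp only [FreeMonoid.ofList_append, map_mul]
  exact hm

variable [Finite M]

theorem preimage_double_marked_le (hright : Covariant M M (Function.swap (· * ·)) (IsPair 𝒞 α))
    (h : IdempotentEquation (IsPair 𝒞 α)) {K : Language A} {p s q m : M} {a b : A}
    (hK : K ≤ preimage α {t | IsPair 𝒞 α s t}) (hm : p * α (.of a) * (s * α (.of b) * q) = m)
    (hp : JLe (p * α (.of a)) m) (hq : JLe (α (.of b) * q) m) :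
    preimage α {p} * {[a]} * (K * {[b]} * preimage α {q}) ≤ preimage α {m} := by
  intro w hw
  obtain ⟨x, hx, _, hz, rfl⟩ := mem_marked_iff.1 hw
  obtain ⟨v, hv, y, hy, rfl⟩ := mem_marked_iff.1 hz
  have hm' : p * α (.of a) * s * (α (.of b) * q) = m := by rw [← hm]; simp only [mul_assoc]
  have heq := h.mul_mul_eq hright (hm'.symm ▸ hp) (hm'.symm ▸ hq) (hK hv)
  rw [hm', ← Set.mem_singleton_iff.1 hx, ← Set.mem_singleton_iff.1 hy] at heq
  refine mem_preimage.2 ?_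
  simp only [FreeMonoid.ofList_append, FreeMonoid.ofList_singleton, map_mul]
  simpa only [mul_assoc] using Set.mem_singleton_iff.2 heq

theorem preimage_singleton_mem_of_one_jLe (hinf : InfClosed 𝒞) (htop : ⊤ ∈ 𝒞)
    (hright : Covariant M M (Function.swap (· * ·)) (IsPair 𝒞 α))
    (h : IdempotentEquation (IsPair 𝒞 α)) {m : M} (hm : JLe 1 m) : preimage α {m} ∈ 𝒞 := by
  obtain ⟨K, hK, hmK, hKpair⟩ := exists_mem_le_preimage_setOf_isPair (α := α) hinf htop m
  convert hK
  refine le_antisymm hmK (hKpair.trans (preimage_mono fun t hmt => ?_))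
  have hm' : JLe 1 (1 * m * 1) := by rwa [one_mul, mul_one]
  simpa only [one_mul, mul_one, Set.mem_singleton_iff] using h.mul_mul_eq hright hm' hm' hmt

theorem preimage_singleton_mem_pol [Finite A] (hinf : InfClosed 𝒞) (hbot : ⊥ ∈ 𝒞) (htop : ⊤ ∈ 𝒞)
    (hright : Covariant M M (Function.swap (· * ·)) (IsPair 𝒞 α))
    (h : IdempotentEquation (IsPair 𝒞 α)) (m : M) : preimage α {m} ∈ Pol 𝒞 := by
  induction m using (wellFounded_strict_jLe (M := M)).induction with
  | _ m ih =>
  by_cases hm : JLe 1 m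
  · exact .base _ (preimage_singleton_mem_of_one_jLe hinf htop hright h hm)
  choose K hK hsK hKpair using exists_mem_le_preimage_setOf_isPair (𝒞 := 𝒞) (α := α) hinf htop
  let single : M × A × M → Language A := fun (p, a, q) =>
    preimage α {p} * {[a]} * preimage α {q}
  let double : M × A × M × A × M → Language A := fun (p, a, s, b, q) =>
    preimage α {p} * {[a]} * (K s * {[b]} * preimage α {q})
  refine mem_of_finite_cover supClosed_pol (.base _ hbot)
    ((Set.finite_range single).union (Set.finite_range double)) fun w hw => ?_
  have hw_le : JLe (α (.ofList w)) m := ⟨1, 1, by rw [one_mul, mul_one]; exact hw⟩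
  have hnil : ¬ JLe (α (.ofList [])) m := by rwa [FreeMonoid.ofList_nil, map_one]
  rcases exists_marked_factorization (P := fun w => JLe (α (.ofList w)) m) hnil hw_le with
    ⟨x, a, z, rfl, hx, hz⟩ | ⟨x, a, v, b, y, rfl, hx, hxa, hby, hy⟩
  all_goals simp only [mem_preimage, FreeMonoid.ofList_append, map_mul] at hw hx
  · refine ⟨_, .inl ⟨(_, a, _), rfl⟩, .marked _ _ a (ih _ ⟨?_, hx⟩) (ih _ ⟨?_, hz⟩),
      mem_marked_iff.2 ⟨x, rfl, z, rfl, rfl⟩, preimage_marked_le hw⟩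
    · rw [← hw]
      exact (mul_jLe_left _ _).trans (mul_jLe_left _ _)
    · rw [← hw]
      exact mul_jLe_right _ _
  · refine ⟨_, .inr ⟨(_, a, _, b, _), rfl⟩,
      .marked _ _ a (ih _ ⟨?_, hx⟩) (.marked _ _ b (.base _ (hK _)) (ih _ ⟨?_, hy⟩)),
      mem_marked_iff.2 ⟨x, rfl, _, mem_marked_iff.2 ⟨v, hsK _ rfl, y, rfl, rfl⟩, rfl⟩,
      preimage_double_marked_le hright h (hKpair _) hw ?_ ?_⟩
    · rw [← hw]
      exact (mul_jLe_left _ _).trans (mul_jLe_left _ _)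
    · rw [← hw]
      exact (mul_jLe_right _ _).trans (mul_jLe_right _ _)
    · rwa [FreeMonoid.ofList_append, map_mul] at hxa
    · rwa [FreeMonoid.ofList_append, map_mul] at hby

theorem preimage_mem_pol [Finite A] (hinf : InfClosed 𝒞) (hbot : ⊥ ∈ 𝒞) (htop : ⊤ ∈ 𝒞)
    (hright : Covariant M M (Function.swap (· * ·)) (IsPair 𝒞 α))
    (h : IdempotentEquation (IsPair 𝒞 α)) (F : Set M) : preimage α F ∈ Pol 𝒞 :=
  mem_of_finite_cover supClosed_pol (.base _ hbot)
    (Set.finite_range fun m => preimage α {m}) fun w hw =>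
      ⟨_, ⟨α (.ofList w), rfl⟩, preimage_singleton_mem_pol hinf hbot htop hright h _, rfl,
        preimage_mono (Set.singleton_subset_iff.2 hw)⟩

end PolOfEquation

section Syntactic

variable {A : Type*} {L : Language A}

theorem syntHom_surjective (L : Language A) : Function.Surjective (syntHom L) :=
  Con.mk'_surjective

theorem syntHom_eq_iff {u v : FreeMonoid A} : syntHom L u = syntHom L v ↔
    ∀ x y : FreeMonoid A, (x * u * y).toList ∈ L ↔ (x * v * y).toList ∈ L :=
  Con.eq _

theorem recognizes_syntHom (L : Language A) : Recognizes (syntHom L) L := by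
  refine ⟨syntHom L '' {w | w.toList ∈ L}, le_antisymm (fun w hw => ⟨.ofList w, hw, rfl⟩) ?_⟩
  rintro w ⟨z, hz, hzw⟩
  have hiff := syntHom_eq_iff.1 hzw 1 1
  simp only [one_mul, mul_one] at hiff
  exact hiff.1 hz

theorem syntMonoid_ext {F : Set (SyntMonoid L)} (hF : L = preimage (syntHom L) F)
    {s t : SyntMonoid L} (h : ∀ x y, x * s * y ∈ F ↔ x * t * y ∈ F) : s = t := by
  obtain ⟨u, rfl⟩ := syntHom_surjective L s
  obtain ⟨v, rfl⟩ := syntHom_surjective L t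
  refine syntHom_eq_iff.2 fun x y => ?_
  have hmem (w : FreeMonoid A) : w.toList ∈ L ↔ syntHom L w ∈ F := by
    conv_lhs => rw [hF]
    exact mem_preimage
  simpa only [hmem, map_mul] using h (syntHom L x) (syntHom L y)

end Syntactic

section Replacement

variable {A : Type*}

theorem mul_eq_marked {x y w z : FreeMonoid A} {a : A} (h : x * y = w * .of a * z) :
    (∃ x', x = w * .of a * x' ∧ z = x' * y) ∨ ∃ y', y = y' * .of a * z ∧ w = x * y' := by
  have hlist : x.toList ++ y.toList = w.toList ++ ([a] ++ z.toList) := by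
    rw [← List.append_assoc]
    exact h
  rcases List.append_eq_append_iff.1 hlist with ⟨c, hw, hy⟩ | ⟨c, hx, hz⟩
  · exact .inr ⟨.ofList c, by rw [mul_assoc]; exact hy, hw⟩
  · rcases List.cons_eq_append_iff.1 hz with ⟨rfl, hy⟩ | ⟨c, rfl, hz'⟩
    · rw [List.append_nil] at hx
      exact .inr ⟨1, by rw [one_mul]; exact hy, by rw [mul_one]; exact hx.symm⟩
    · exact .inl ⟨.ofList c, by rw [mul_assoc]; exact hx, hz'⟩

theorem prod_eq_marked {us : List (FreeMonoid A)} {w z : FreeMonoid A} {a : A}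
    (h : us.prod = w * .of a * z) : ∃ us₁ u' u'' us₂,
      us = us₁ ++ (u' * .of a * u'') :: us₂ ∧ w = us₁.prod * u' ∧ z = u'' * us₂.prod := by
  induction us generalizing w with
  | nil =>
    have hlength := congrArg FreeMonoid.length h
    simp only [List.prod_nil, FreeMonoid.length_one, FreeMonoid.length_mul,
      FreeMonoid.length_of] at hlength
    omega
  | cons u us ih =>
    rw [List.prod_cons] at h
    rcases mul_eq_marked h with ⟨u'', rfl, rfl⟩ | ⟨w', hus, rfl⟩
    · exact ⟨[], w, u'', us, rfl, (one_mul w).symm, rfl⟩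
    · obtain ⟨us₁, u', u'', us₂, rfl, rfl, rfl⟩ := ih hus
      exact ⟨u :: us₁, u', u'', us₂, rfl, by rw [List.prod_cons, mul_assoc], rfl⟩

/-- In every word of `L` and every block of at least `h` consecutive factors of it, some factor `u`
may be replaced by any word above `u` in the preorder of `𝒟`. -/
def AdmitsReplacement (𝒟 : Set (Language A)) (h : ℕ) (L : Language A) : Prop :=
  ∀ (x y : FreeMonoid A) (us : List (FreeMonoid A)), h ≤ us.length →
    (x * us.prod * y).toList ∈ L → ∃ us₁ u us₂, us = us₁ ++ u :: us₂ ∧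
      ∀ v, CanonicalLE 𝒟 u v → (x * (us₁ ++ v :: us₂).prod * y).toList ∈ L

namespace AdmitsReplacement

variable {𝒟 ℰ : Set (Language A)} {g h : ℕ} {H L : Language A}

theorem mono (hle : 𝒟 ⊆ ℰ) (hgh : g ≤ h) (hL : AdmitsReplacement 𝒟 g L) :
    AdmitsReplacement ℰ h L := by
  intro x y us hus hmem
  obtain ⟨us₁, u, us₂, rfl, hrepl⟩ := hL x y us (hgh.trans hus) hmem
  exact ⟨us₁, u, us₂, rfl, fun v huv => hrepl v (huv.mono hle)⟩

theorem sup (hH : AdmitsReplacement 𝒟 h H) (hL : AdmitsReplacement 𝒟 h L) :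
    AdmitsReplacement 𝒟 h (H ⊔ L) := by
  rintro x y us hus (hmem | hmem)
  · obtain ⟨us₁, u, us₂, rfl, hrepl⟩ := hH x y us hus hmem
    exact ⟨us₁, u, us₂, rfl, fun v huv => .inl (hrepl v huv)⟩
  · obtain ⟨us₁, u, us₂, rfl, hrepl⟩ := hL x y us hus hmem
    exact ⟨us₁, u, us₂, rfl, fun v huv => .inr (hrepl v huv)⟩

theorem marked (hH : AdmitsReplacement 𝒟 h H) (hL : AdmitsReplacement 𝒟 g L) (a : A) :
    AdmitsReplacement 𝒟 (h + g + 1) (H * {[a]} * L) := by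
  intro x y us hus hmem
  have hmark {w z : FreeMonoid A} (hw : w.toList ∈ H) (hz : z.toList ∈ L) :
      (w * .of a * z).toList ∈ H * {[a]} * L := mem_marked_iff.2 ⟨_, hw, _, hz, rfl⟩
  obtain ⟨w, hw, z, hz, hwz⟩ : ∃ w : FreeMonoid A, w.toList ∈ H ∧ ∃ z : FreeMonoid A,
      z.toList ∈ L ∧ x * us.prod * y = w * .of a * z := mem_marked_iff.1 hmem
  rcases mul_eq_marked hwz with ⟨z', hxus, rfl⟩ | ⟨y', rfl, rfl⟩
  · rcases mul_eq_marked hxus with ⟨x', rfl, rfl⟩ | ⟨w', hprod, rfl⟩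
    · obtain ⟨us₁, u, us₂, rfl, hrepl⟩ := hL x' y us (by omega) hz
      exact ⟨us₁, u, us₂, rfl, fun v huv => by
        simpa only [mul_assoc] using hmark hw (hrepl v huv)⟩
    · obtain ⟨us₁, u', u'', us₂, rfl, rfl, rfl⟩ := prod_eq_marked hprod
      rw [List.length_append, List.length_cons] at hus
      rcases le_total h us₁.length with hus₁ | hus₁
      · rw [← mul_assoc] at hw
        obtain ⟨vs₁, u, vs₂, rfl, hrepl⟩ := hH x u' us₁ hus₁ hw
        refine ⟨vs₁, u, vs₂ ++ (u' * .of a * u'') :: us₂, by simp, fun v huv => ?_⟩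
        simpa [mul_assoc] using hmark (hrepl v huv) hz
      · obtain ⟨vs₁, u, vs₂, rfl, hrepl⟩ := hL u'' y us₂ (by omega) hz
        refine ⟨us₁ ++ (u' * .of a * u'') :: vs₁, u, vs₂, by simp, fun v huv => ?_⟩
        simpa [mul_assoc] using hmark hw (hrepl v huv)
  · obtain ⟨us₁, u, us₂, rfl, hrepl⟩ := hH x y' us (by omega) hw
    exact ⟨us₁, u, us₂, rfl, fun v huv => by
      simpa only [mul_assoc] using hmark (hrepl v huv) hz⟩

end AdmitsReplacement

/-- The two-sided quotients `p⁻¹ L q⁻¹` of `L` by words. -/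
def quotients (L : Language A) : Set (Language A) :=
  Set.range fun p : FreeMonoid A × FreeMonoid A =>
    rightQuotient (L.leftQuotient p.1.toList) p.2.toList

theorem mem_rightQuotient_leftQuotient {L : Language A} {x w y : FreeMonoid A} :
    w.toList ∈ rightQuotient (L.leftQuotient x.toList) y.toList ↔ (x * w * y).toList ∈ L := by
  rw [mul_assoc]
  rfl

theorem admitsReplacement_quotients (L : Language A) : AdmitsReplacement (quotients L) 1 L := by
  intro x y us hus hmem
  obtain ⟨u, us, rfl⟩ := List.exists_cons_of_length_pos hus
  refine ⟨[], u, us, rfl, fun v huv => ?_⟩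
  have hmem' : (x * u * (us.prod * y)).toList ∈ L := by
    simpa only [List.prod_cons, mul_assoc] using hmem
  have := huv _ ⟨(x, us.prod * y), rfl⟩ (mem_rightQuotient_leftQuotient.2 hmem')
  simpa only [List.nil_append, List.prod_cons, mul_assoc] using
    mem_rightQuotient_leftQuotient.1 this

theorem finite_quotients {L : Language A} (hL : L.IsRegular) : (quotients L).Finite := by
  have := finite_syntMonoid hL
  let quot (p : FreeMonoid A × FreeMonoid A) :=
    rightQuotient (L.leftQuotient p.1.toList) p.2.toList
  have hfactor : quot.FactorsThrough (Prod.map (syntHom L) (syntHom L)) := by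
    rintro ⟨x, y⟩ ⟨x', y'⟩ hxy
    obtain ⟨hx, hy⟩ := Prod.mk.inj hxy
    ext w
    have h₁ := syntHom_eq_iff.1 hx 1 (.ofList w * y)
    have h₂ := syntHom_eq_iff.1 hy (x' * .ofList w) 1
    simp only [one_mul, mul_one, ← mul_assoc] at h₁ h₂
    exact mem_rightQuotient_leftQuotient.trans <| h₁.trans <| h₂.trans
      mem_rightQuotient_leftQuotient.symm
  obtain ⟨f, hf⟩ := (Function.factorsThrough_iff _).1 hfactor
  have hquot : quotients L ⊆ Set.range f := by
    change Set.range quot ⊆ _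
    rw [hf]
    exact Set.range_comp_subset_range _ _
  exact (Set.finite_range f).subset hquot

theorem InPol.exists_admitsReplacement {𝒞 : Set (Language A)} (h𝒞 : ∀ K ∈ 𝒞, K.IsRegular)
    (hquot : ∀ K ∈ 𝒞, quotients K ⊆ 𝒞) {L : Language A} (hL : InPol 𝒞 L) :
    ∃ 𝒟 ⊆ 𝒞, 𝒟.Finite ∧ ∃ h, AdmitsReplacement 𝒟 h L := by
  induction hL with
  | base L hL =>
    exact ⟨_, hquot L hL, finite_quotients (h𝒞 L hL), 1, admitsReplacement_quotients L⟩
  | union H L _ _ ihH ihL =>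
    obtain ⟨𝒟, h𝒟, h𝒟fin, h, hH⟩ := ihH
    obtain ⟨ℰ, hℰ, hℰfin, g, hL⟩ := ihL
    exact ⟨𝒟 ∪ ℰ, Set.union_subset h𝒟 hℰ, h𝒟fin.union hℰfin, max h g,
      (hH.mono Set.subset_union_left (le_max_left h g)).sup
        (hL.mono Set.subset_union_right (le_max_right h g))⟩
  | marked H L a _ _ ihH ihL =>
    obtain ⟨𝒟, h𝒟, h𝒟fin, h, hH⟩ := ihH
    obtain ⟨ℰ, hℰ, hℰfin, g, hL⟩ := ihL
    exact ⟨𝒟 ∪ ℰ, Set.union_subset h𝒟 hℰ, h𝒟fin.union hℰfin, h + g + 1,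
      (hH.mono Set.subset_union_left le_rfl).marked (hL.mono Set.subset_union_right le_rfl) a⟩

end Replacement

namespace IsQuotientingLattice

variable {A : Type*} {𝒞 : Set (Language A)}

theorem supClosed (h𝒞 : IsQuotientingLattice 𝒞) : SupClosed 𝒞 :=
  fun K hK L hL => h𝒞.union_mem K hK L hL

theorem infClosed (h𝒞 : IsQuotientingLattice 𝒞) : InfClosed 𝒞 :=
  fun K hK L hL => h𝒞.inter_mem K hK L hL

theorem quotients_subset (h𝒞 : IsQuotientingLattice 𝒞) {L : Language A} (hL : L ∈ 𝒞) :
    quotients L ⊆ 𝒞 := by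
  rintro _ ⟨⟨x, y⟩, rfl⟩
  exact h𝒞.rightQuotient_mem _ (h𝒞.leftQuotient_mem L hL _) _

variable {M : Type*} [Monoid M] {α : FreeMonoid A →* M}

theorem mul_mul_mem_of_preimage_mem_pol (h𝒞 : IsQuotientingLattice 𝒞)
    (hα : Function.Surjective α) {F : Set M} (hF : preimage α F ∈ Pol 𝒞) {e t x y : M}
    (he : IsIdempotentElem e) (het : IsPair 𝒞 α e t) (hmem : x * e * y ∈ F) :
    x * (e * t * e) * y ∈ F := by
  obtain ⟨𝒟, h𝒟, h𝒟fin, h, hrepl⟩ := hF.exists_admitsReplacement h𝒞.regular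
    fun K hK => h𝒞.quotients_subset hK
  have hpair : IsPair 𝒞 α (e * e * e) (e * t * e) :=
    covariant_swap_mul_isPair h𝒞.rightQuotient_mem hα e
      (covariant_mul_isPair h𝒞.leftQuotient_mem hα e het)
  obtain ⟨u, v, hu, hv, huv⟩ := exists_canonicalLE_of_isPair h𝒞.supClosed h𝒞.infClosed
    h𝒞.empty_mem h𝒞.univ_mem h𝒟fin h𝒟 hpair
  rw [he.eq, he.eq] at hu
  obtain ⟨x, rfl⟩ := hα x
  obtain ⟨y, rfl⟩ := hα y
  have hblock : (x * (List.replicate (h + 1) u).prod * y).toList ∈ preimage α F := by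
    refine mem_preimage.2 ?_
    rwa [List.prod_replicate, FreeMonoid.ofList_toList, map_mul, map_mul, map_pow, hu,
      he.pow_eq h.succ_ne_zero]
  obtain ⟨us₁, u', us₂, hus, hmem'⟩ :=
    hrepl x y _ (by rw [List.length_replicate]; exact h.le_succ) hblock
  obtain ⟨-, hus₁, hus₂⟩ := List.append_eq_replicate_iff.1 hus.symm
  rw [List.length_cons, List.replicate_succ, List.cons.injEq] at hus₂
  obtain ⟨rfl, hus₂⟩ := hus₂
  have himage : α (us₁ ++ v :: us₂).prod = e * t * e := by
    rw [hus₁, hus₂, List.prod_append, List.prod_cons, List.prod_replicate, List.prod_replicate,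
      map_mul, map_mul, map_pow, map_pow, hu, hv]
    calc e ^ us₁.length * (e * t * e * e ^ _) = e ^ us₁.length * e * t * (e * e ^ us₂.length) := by
          simp only [mul_assoc]
      _ = e * t * e := by rw [← pow_succ, ← pow_succ', he.pow_succ_eq,
            he.pow_succ_eq]
  simpa only [mem_preimage, FreeMonoid.ofList_toList, map_mul, himage] using hmem' v huv

theorem idempotentEquation_of_mem_pol_inter_coPol (h𝒞 : IsQuotientingLattice 𝒞) {L : Language A}
    (hL : L ∈ Pol 𝒞 ∩ coPol 𝒞) : IdempotentEquation (IsPair 𝒞 (syntHom L)) := by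
  obtain ⟨F, hF⟩ := recognizes_syntHom L
  have hFc : Lᶜ = preimage (syntHom L) Fᶜ := congrArg compl hF
  have hpol : preimage (syntHom L) F ∈ Pol 𝒞 := hF ▸ hL.1
  have hpolc : preimage (syntHom L) Fᶜ ∈ Pol 𝒞 := hFc ▸ mem_coPol.1 hL.2
  intro e t he het
  refine syntMonoid_ext hF fun x y => ⟨fun hmem => ?_, fun hmem => ?_⟩
  · by_contra hcompl
    exact h𝒞.mul_mul_mem_of_preimage_mem_pol (F := Fᶜ) (syntHom_surjective L) hpolc he het
      hcompl hmem
  · exact h𝒞.mul_mul_mem_of_preimage_mem_pol (syntHom_surjective L) hpol he het hmem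

theorem mem_pol_inter_coPol [Finite A] (h𝒞 : IsQuotientingLattice 𝒞) {L : Language A}
    [Finite (SyntMonoid L)] (h : IdempotentEquation (IsPair 𝒞 (syntHom L))) :
    L ∈ Pol 𝒞 ∩ coPol 𝒞 := by
  have hpol := preimage_mem_pol h𝒞.infClosed h𝒞.empty_mem h𝒞.univ_mem
    (covariant_swap_mul_isPair h𝒞.rightQuotient_mem (syntHom_surjective L)) h
  obtain ⟨F, hF⟩ := recognizes_syntHom L
  have hFc : Lᶜ = preimage (syntHom L) Fᶜ := congrArg compl hF
  exact ⟨hF ▸ hpol F, mem_coPol.2 (hFc ▸ hpol Fᶜ)⟩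

end IsQuotientingLattice

end PolClosure

theorem mainTheorem3 {A : Type*} [Finite A] (𝒞 : Set (Language A))
    (h𝒞 : PolClosure.IsQuotientingLattice 𝒞) :
    (∀ L : Language A, L.IsRegular →
      List.TFAE [
        L ∈ PolClosure.Pol 𝒞 ∩ PolClosure.coPol 𝒞,
        ∀ s t : PolClosure.SyntMonoid L,
          PolClosure.IsPair 𝒞 (PolClosure.syntHom L) s t →
            s ^ (PolClosure.omega (PolClosure.SyntMonoid L) + 1) =
              s ^ PolClosure.omega (PolClosure.SyntMonoid L) * t *
                s ^ PolClosure.omega (PolClosure.SyntMonoid L),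
        ∀ s t : PolClosure.SyntMonoid L,
          PolClosure.IsSaturatedPair 𝒞 (PolClosure.syntHom L) s t →
            s ^ (PolClosure.omega (PolClosure.SyntMonoid L) + 1) =
              s ^ PolClosure.omega (PolClosure.SyntMonoid L) * t *
                s ^ PolClosure.omega (PolClosure.SyntMonoid L)]) ∧
    (∀ (M : Type*) [Monoid M] [Finite M] (α : FreeMonoid A →* M), Function.Surjective α →
      ∀ s t : M, PolClosure.IsSaturatedPair 𝒞 α s t ↔
        Relation.TransGen (PolClosure.IsPair 𝒞 α) s t) := by
  refine ⟨fun L hL => ?_, fun M _ _ α _ s t => PolClosure.isSaturatedPair_iff_transGen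
    h𝒞.supClosed h𝒞.infClosed h𝒞.empty_mem h𝒞.univ_mem⟩
  have := PolClosure.finite_syntMonoid hL
  have hα := PolClosure.syntHom_surjective L
  have hleft := PolClosure.covariant_mul_isPair h𝒞.leftQuotient_mem hα
  have hright := PolClosure.covariant_swap_mul_isPair h𝒞.rightQuotient_mem hα
  have hiff := PolClosure.idempotentEquation_iff_omega hright
  tfae_have 1 → 2 := fun h => hiff.1 (h𝒞.idempotentEquation_of_mem_pol_inter_coPol h)
  tfae_have 2 → 1 := fun h => h𝒞.mem_pol_inter_coPol (hiff.2 h)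
  tfae_have 2 → 3 := fun h s t hst =>
    have htrans := (hiff.2 h).transGen hleft hright
    (PolClosure.idempotentEquation_iff_omega (PolClosure.covariant_transGen hright)).1 htrans s t
      ((PolClosure.isSaturatedPair_iff_transGen h𝒞.supClosed h𝒞.infClosed h𝒞.empty_mem
        h𝒞.univ_mem).1 hst)
  tfae_have 3 → 2 := fun h s t hst => h s t hst.isSaturatedPair
  tfae_finish
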